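/- **Setting.** Let $P$ be a smooth (finite-dimensional, Hausdorff, second countable) manifold without boundary, $R=C^\infty(P)$, and let $A\to P$ be a (real, smooth, finite-rank) Lie algebroid: a vector bundle with a real Lie bracket on its space $\Gamma(A)$ of smooth sections and a smooth bundle map $\rho:A\to TP$ over $\mathrm{id}_P$ (the anchor) such that $\rho([X,Y])=[\rho(X),\rho(Y)]$ and $[X,fY]=f[X,Y]+(\rho(X)f)\,Y$ for all $X,Y\in\Gamma(A)$, $f\in R$. **The universal enveloping algebra.** $R\oplus\Gamma(A)$ is a real Lie algebra with bracket $[f+X,g+Y]=(\rho(X)g-\rho(Y)f)+[X,Y]$. Let $U$ be its usual (unital) universal enveloping algebra, with canonical images $f'$, $X'$ of $f\in R$, $X\in\Gamma(A)$. Then $UA=U/I$, where $I$ is the two-sided ideal generated by all $(fg)'-f'g'$, all $(fX)'-f'X'$, and $1'-1$. Let $i_1:R\to UA$ (an algebra homomorphism) and $i_2:\Gamma(A)\to UA$ be the induced maps. **Hopf algebroids.** Let $k$ be a ground ring. A Hopf algebroid $(H,R,\alpha,\beta,m,\Delta,\epsilon)$ (no antipode is required) consists of $k$-algebras $H$ (with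 product $m$) and $R$, an algebra homomorphism $\alpha:R\to H$ (source) and an algebra anti-homomorphism $\beta:R\to H$ (target) with commuting images, so that $H$ is an $(R,R)$-bimodule by $a\cdot h=\alpha(a)h$, $h\cdot a=\beta(a)h$; an $(R,R)$-bimodule map $\Delta:H\to H\otimes_RH$ with $\Delta(1)=1\otimes 1$, $(\Delta\otimes_R\mathrm{id})\Delta=(\mathrm{id}\otimes_R\Delta)\Delta$, $\Delta(h)(\beta(a)\otimes1-1\otimes\alpha(a))=0$ in $H\otimes_RH$, and $\Delta(h_1h_2)=\Delta(h_1)\Delta(h_2)$ (a product that is well defined by the preceding condition); and an $(R,R)$-bimodule map $\epsilon:H\to R$ with $\epsilon(1)=1$ and $(\epsilon\otimes_R\mathrm{id})\Delta=(\mathrm{id}\otimes_R\epsilon)\Delta=\mathrm{id}$. It is cocommutative if $\alpha=\beta$ and $\Delta$ is invariant under the flip $x\otimes y\mapsto y\otimes x$ of $H\otimes_RH$. An anchor is a representation $\mu:H\to\mathrm{End}_k R$, written $x(a)=\mu(x)(a)$, which is an $(R,R)$-bimodule map (where $(a\cdot\varphi)(b)=a\,\varphi(b)$, $(\varphi\cdot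 a)(b)=\varphi(b)\,a$) and satisfies, for all $x\in H$, $a\in R$ with $\Delta x=\sum x_1\otimes x_2$: $\sum \alpha(x_1(a))\,x_2=x\,\alpha(a)$, $\sum\beta(x_2(a))\,x_1=x\,\beta(a)$, and $x(1_R)=\epsilon(x)$. **Theorem.** The map $i_1$ is injective, and there is a cocommutative Hopf algebroid $(UA,R,\alpha,\beta,m,\Delta,\epsilon)$ over the ground field $\mathbb R$, where $m$ is the product of $UA$, with anchor $\mu$, such that: 1. $\alpha=\beta=i_1$; 2. $\Delta(i_1(f))=i_1(f)\otimes 1$ for $f\in R$, and $\Delta(i_2(X))=i_2(X)\otimes1+1\otimes i_2(X)$ for $X\in\Gamma(A)$; 3. there is an algebra homomorphism $\rho:UA\to\mathcal D(P)$ into the algebra of differential operators on $P$ (the subalgebra of $\mathrm{End}_{\mathbb R}R$ generated by functions and vector fields) which extends the anchor of $A$, that is $\rho(i_1(f))g=fg$ and $\rho(i_2(X))g=\rho(X)g$, and the anchor of the Hopf algebroid is $\mu(x)(f)=\rho(x)(f)$; 4. $\epsilon$ is the projection of $UA$ onto $R$ along the left ideal generated by the sections: $\epsilon(i_1(f))=f$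 for $f\in R$, and $\ker\epsilon$ is the left ideal $UA\cdot i_2(\Gamma(A))$. -/

import Mathlib

open scoped TensorProduct Manifold ContDiff Bundle

noncomputable section

/-! ### Bimodules over a possibly noncommutative algebra and their tensor products -/

/-- An `(R, R)`-bimodule structure on the `k`-module `M`: commuting left and right actions of the
`k`-algebra `R`; `right (op a) m` is `m · a`. -/
structure RBimodule (k R M : Type*) [CommRing k] [Ring R] [Algebra k R]
    [AddCommGroup M] [Module k M] where
  left : R →ₐ[k] Module.End k M
  right : Rᵐᵒᵖ →ₐ[k] Module.End k M
  left_right : ∀ (a : R) (b : Rᵐᵒᵖ) (m : M), left a (right b m) = right b (left a m)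

namespace RBimodule

variable {k R M N L M' N' : Type*} [CommRing k] [Ring R] [Algebra k R]
  [AddCommGroup M] [Module k M] [AddCommGroup N] [Module k N] [AddCommGroup L] [Module k L]
  [AddCommGroup M'] [Module k M'] [AddCommGroup N'] [Module k N']

/-- A `k`-linear map is a map of `(R, R)`-bimodules. -/
structure IsHom (B : RBimodule k R M) (C : RBimodule k R N) (f : M →ₗ[k] N) : Prop where
  map_left : ∀ (a : R) (m : M), f (B.left a m) = C.left a (f m)
  map_right : ∀ (b : Rᵐᵒᵖ) (m : M), f (B.right b m) = C.right b (f m)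

theorem isHom_id (B : RBimodule k R M) : IsHom B B LinearMap.id := ⟨fun _ _ => rfl, fun _ _ => rfl⟩

/-- The relations `m · a ⊗ n = m ⊗ a · n`. -/
def relations (B : RBimodule k R M) (C : RBimodule k R N) : Submodule k (M ⊗[k] N) :=
  Submodule.span k {t | ∃ (a : R) (m : M) (n : N),
    t = B.right (MulOpposite.op a) m ⊗ₜ[k] n - m ⊗ₜ[k] C.left a n}

/-- The tensor product `M ⊗_R N` of two `(R, R)`-bimodules. -/
abbrev Tens (B : RBimodule k R M) (C : RBimodule k R N) : Type _ := (M ⊗[k] N) ⧸ relations B C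

/-- The class of `m ⊗ n` in `M ⊗_R N`. -/
def tmul (B : RBimodule k R M) (C : RBimodule k R N) (m : M) (n : N) : Tens B C :=
  (relations B C).mkQ (m ⊗ₜ[k] n)

theorem tmul_balanced (B : RBimodule k R M) (C : RBimodule k R N) (a : R) (m : M) (n : N) :
    tmul B C (B.right (MulOpposite.op a) m) n = tmul B C m (C.left a n) :=
  (Submodule.Quotient.eq _).2 (Submodule.subset_span ⟨a, m, n, rfl⟩)

/-- A `k`-linear map on `M ⊗_k N` that respects the relations descends to `M ⊗_R N`. -/
def lift (B : RBimodule k R M) (C : RBimodule k R N) (φ : M ⊗[k] N →ₗ[k] L)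
    (h : ∀ (a : R) (m : M) (n : N),
      φ (B.right (MulOpposite.op a) m ⊗ₜ[k] n) = φ (m ⊗ₜ[k] C.left a n)) :
    Tens B C →ₗ[k] L :=
  (relations B C).liftQ φ (by
    refine Submodule.span_le.2 ?_
    rintro _ ⟨a, m, n, rfl⟩
    simp [h])

@[simp]
theorem lift_tmul (B : RBimodule k R M) (C : RBimodule k R N) (φ : M ⊗[k] N →ₗ[k] L)
    (h : ∀ (a : R) (m : M) (n : N),
      φ (B.right (MulOpposite.op a) m ⊗ₜ[k] n) = φ (m ⊗ₜ[k] C.left a n)) (m : M) (n : N) :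
    lift B C φ h (tmul B C m n) = φ (m ⊗ₜ[k] n) := rfl

theorem tens_ext {B : RBimodule k R M} {C : RBimodule k R N} {f g : Tens B C →ₗ[k] L}
    (h : ∀ m n, f (tmul B C m n) = g (tmul B C m n)) : f = g :=
  Submodule.linearMap_qext _ (TensorProduct.ext' h)

/-- `f ⊗_R g` for bimodule maps `f` and `g`. -/
def map {B : RBimodule k R M} {C : RBimodule k R N} {B' : RBimodule k R M'} {C' : RBimodule k R N'}
    (f : M →ₗ[k] M') (hf : IsHom B B' f) (g : N →ₗ[k] N') (hg : IsHom C C' g) :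
    Tens B C →ₗ[k] Tens B' C' :=
  lift B C ((relations B' C').mkQ ∘ₗ TensorProduct.map f g) (fun a m n => by
    have := tmul_balanced B' C' a (f m) (g n)
    simpa [tmul, hf.map_right, hg.map_left] using this)

@[simp]
theorem map_tmul {B : RBimodule k R M} {C : RBimodule k R N} {B' : RBimodule k R M'}
    {C' : RBimodule k R N'} (f : M →ₗ[k] M') (hf : IsHom B B' f) (g : N →ₗ[k] N')
    (hg : IsHom C C' g) (m : M) (n : N) :
    map f hf g hg (tmul B C m n) = tmul B' C' (f m) (g n) := rfl

/-- The left action `a · (m ⊗ n) = (a · m) ⊗ n`. -/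
def tensLeft (B : RBimodule k R M) (C : RBimodule k R N) (a : R) : Tens B C →ₗ[k] Tens B C :=
  lift B C ((relations B C).mkQ ∘ₗ TensorProduct.map (B.left a) LinearMap.id) (fun b m n => by
    have := tmul_balanced B C b (B.left a m) n
    simpa [tmul, B.left_right] using this)

/-- The right action `(m ⊗ n) · b = m ⊗ (n · b)`. -/
def tensRight (B : RBimodule k R M) (C : RBimodule k R N) (b : Rᵐᵒᵖ) : Tens B C →ₗ[k] Tens B C :=
  lift B C ((relations B C).mkQ ∘ₗ TensorProduct.map LinearMap.id (C.right b)) (fun a m n => by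
    have := tmul_balanced B C a m (C.right b n)
    simpa [tmul, C.left_right] using this)

@[simp]
theorem tensLeft_tmul (B : RBimodule k R M) (C : RBimodule k R N) (a : R) (m : M) (n : N) :
    tensLeft B C a (tmul B C m n) = tmul B C (B.left a m) n := rfl

@[simp]
theorem tensRight_tmul (B : RBimodule k R M) (C : RBimodule k R N) (b : Rᵐᵒᵖ) (m : M) (n : N) :
    tensRight B C b (tmul B C m n) = tmul B C m (C.right b n) := rfl

theorem tmul_add (B : RBimodule k R M) (C : RBimodule k R N) (m : M) (n n' : N) :
    tmul B C m (n + n') = tmul B C m n + tmul B C m n' := by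
  simp [tmul, TensorProduct.tmul_add]

theorem add_tmul (B : RBimodule k R M) (C : RBimodule k R N) (m m' : M) (n : N) :
    tmul B C (m + m') n = tmul B C m n + tmul B C m' n := by
  simp [tmul, TensorProduct.add_tmul]

theorem tmul_smul (B : RBimodule k R M) (C : RBimodule k R N) (c : k) (m : M) (n : N) :
    tmul B C m (c • n) = c • tmul B C m n := by
  simp [tmul]

theorem smul_tmul (B : RBimodule k R M) (C : RBimodule k R N) (c : k) (m : M) (n : N) :
    tmul B C (c • m) n = c • tmul B C m n := by
  simp [tmul, ← TensorProduct.smul_tmul']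

/-- The bimodule `M ⊗_R N`. -/
def tens (B : RBimodule k R M) (C : RBimodule k R N) : RBimodule k R (Tens B C) where
  left := AlgHom.ofLinearMap
    { toFun := tensLeft B C
      map_add' := fun a b => tens_ext fun m n => by simp [add_tmul]
      map_smul' := fun c a => tens_ext fun m n => by simp [smul_tmul] }
    (tens_ext fun m n => by simp) (fun a b => tens_ext fun m n => by simp)
  right := AlgHom.ofLinearMap
    { toFun := tensRight B C
      map_add' := fun a b => tens_ext fun m n => by simp [tmul_add]
      map_smul' := fun c a => tens_ext fun m n => by simp [tmul_smul] }
    (tens_ext fun m n => by simp) (fun a b => tens_ext fun m n => by simp)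
  left_right a b t := by
    have : tensLeft B C a ∘ₗ tensRight B C b = tensRight B C b ∘ₗ tensLeft B C a :=
      tens_ext fun m n => by simp
    exact LinearMap.congr_fun this t

/-- The bimodule `R`, with left and right multiplication. -/
def regular (k R : Type*) [CommRing k] [Ring R] [Algebra k R] : RBimodule k R R where
  left := Algebra.lmul k R
  right := AlgHom.ofLinearMap
    { toFun := fun b => LinearMap.mulRight k b.unop
      map_add' := fun a b => LinearMap.ext fun x => by simp [mul_add]
      map_smul' := fun c a => LinearMap.ext fun x => by simp }
    (LinearMap.ext fun x => by simp) (fun a b => LinearMap.ext fun x => by simp [mul_assoc])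
  left_right a b m := by simp [mul_assoc]

/-- The bimodule `End_k R`: `(a · φ) x = a * φ x` and `(φ · a) x = φ x * a`. -/
def endBimodule (k R : Type*) [CommRing k] [Ring R] [Algebra k R] :
    RBimodule k R (Module.End k R) where
  left := AlgHom.ofLinearMap
    { toFun := fun a => LinearMap.mulLeft k (LinearMap.mulLeft k a : Module.End k R)
      map_add' := fun a b => LinearMap.ext fun x => LinearMap.ext fun y => by simp [add_mul]
      map_smul' := fun c a => LinearMap.ext fun x => LinearMap.ext fun y => by simp }
    (LinearMap.ext fun x => LinearMap.ext fun y => by simp)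
    (fun a b => LinearMap.ext fun x => LinearMap.ext fun y => by simp)
  right := AlgHom.ofLinearMap
    { toFun := fun b => LinearMap.mulLeft k (LinearMap.mulRight k b.unop : Module.End k R)
      map_add' := fun a b => LinearMap.ext fun x => LinearMap.ext fun y => by simp [mul_add]
      map_smul' := fun c a => LinearMap.ext fun x => LinearMap.ext fun y => by simp }
    (LinearMap.ext fun x => LinearMap.ext fun y => by simp)
    (fun a b => LinearMap.ext fun x => LinearMap.ext fun y => by simp [mul_assoc])
  left_right a b φ := LinearMap.ext fun y => by simp [mul_assoc]

/-- The canonical map `R ⊗_R M → M`, `a ⊗ m ↦ a · m` (an isomorphism). -/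
def lid (B : RBimodule k R M) : Tens (regular k R) B →ₗ[k] M :=
  lift (regular k R) B (TensorProduct.lift B.left.toLinearMap) (fun a b m => by
    simp [regular])

/-- The canonical map `M ⊗_R R → M`, `m ⊗ a ↦ m · a` (an isomorphism). -/
def rid (B : RBimodule k R M) : Tens B (regular k R) →ₗ[k] M :=
  lift B (regular k R)
    (TensorProduct.lift
      (B.right.toLinearMap ∘ₗ (MulOpposite.opLinearEquiv k : R ≃ₗ[k] Rᵐᵒᵖ).toLinearMap).flip)
    (fun a m b => by simp [regular])

/-- The canonical map `(M ⊗_R N) ⊗_R L → M ⊗_R (N ⊗_R L)` (an isomorphism). -/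
def assoc (B : RBimodule k R M) (C : RBimodule k R N) (D : RBimodule k R L) :
    Tens (tens B C) D →ₗ[k] Tens B (tens C D) :=
  lift (tens B C) D
    (TensorProduct.lift (lift B C
      (TensorProduct.lift (LinearMap.mk₂ k
        (fun (m : M) (n : N) =>
          (relations B (tens C D)).mkQ ∘ₗ TensorProduct.mk k M (Tens C D) m ∘ₗ
            (relations C D).mkQ ∘ₗ TensorProduct.mk k N L n)
        (fun m m' n => LinearMap.ext fun l => by simp)
        (fun c m n => LinearMap.ext fun l => by simp)
        (fun m n n' => LinearMap.ext fun l => by simp [TensorProduct.tmul_add])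
        (fun c m n => LinearMap.ext fun l => by simp)))
      (fun a m n => LinearMap.ext fun l => tmul_balanced B (tens C D) a m (tmul C D n l))))
    (fun a t l => by
      have : ∀ t : Tens B C, ∀ f g : Tens B C →ₗ[k] Tens B (tens C D),
          (∀ m n, f (tmul B C m n) = g (tmul B C m n)) → f t = g t :=
        fun t f g h => by rw [tens_ext h]
      simp only [TensorProduct.lift.tmul]
      refine this t ((LinearMap.flip _ l) ∘ₗ tensRight B C (MulOpposite.op a))
        (LinearMap.flip _ (D.left a l)) fun m n => ?_
      exact congrArg (tmul B (tens C D) m) (tmul_balanced C D a n l))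

@[simp]
theorem assoc_tmul (B : RBimodule k R M) (C : RBimodule k R N) (D : RBimodule k R L)
    (m : M) (n : N) (l : L) :
    assoc B C D (tmul (tens B C) D (tmul B C m n) l) = tmul B (tens C D) m (tmul C D n l) := rfl

end RBimodule

/-! ### Hopf algebroids -/

open RBimodule

/-- An algebra `H` with a source map (an algebra homomorphism) and a target map (an algebra
anti-homomorphism) from the base algebra `R`, with commuting images. -/
structure SourceTarget (k R H : Type*) [CommRing k] [Ring R] [Algebra k R]
    [Ring H] [Algebra k H] where
  source : R →ₐ[k] H
  target : Rᵐᵒᵖ →ₐ[k] H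
  source_target : ∀ (a : R) (b : Rᵐᵒᵖ), source a * target b = target b * source a

namespace SourceTarget

variable {k R H : Type*} [CommRing k] [Ring R] [Algebra k R] [Ring H] [Algebra k H]

/-- The `(R, R)`-bimodule `H`, with `a · h = α(a) h` and `h · a = β(a) h`. -/
def bimod (S : SourceTarget k R H) : RBimodule k R H where
  left := (Algebra.lmul k H).comp S.source
  right := (Algebra.lmul k H).comp S.target
  left_right a b h := by simp [← mul_assoc, S.source_target]

@[simp]
theorem bimod_left (S : SourceTarget k R H) (a : R) (h : H) : S.bimod.left a h = S.source a * h :=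
  rfl

@[simp]
theorem bimod_right (S : SourceTarget k R H) (b : Rᵐᵒᵖ) (h : H) :
    S.bimod.right b h = S.target b * h :=
  rfl

/-- `H ⊗_R H`. -/
abbrev HH (S : SourceTarget k R H) : Type _ := Tens S.bimod S.bimod

/-- Right multiplication `t ↦ t u` on `H ⊗_R H` by an element `u` of the algebra `H ⊗_k H`. -/
def rightMul (S : SourceTarget k R H) (u : H ⊗[k] H) : S.HH →ₗ[k] S.HH :=
  lift S.bimod S.bimod ((relations S.bimod S.bimod).mkQ ∘ₗ LinearMap.mulRight k u)
    (fun a x y => by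
      induction u using TensorProduct.induction_on with
      | zero => simp
      | tmul p q =>
        have := tmul_balanced S.bimod S.bimod a (x * p) (y * q)
        simpa only [tmul, LinearMap.comp_apply, LinearMap.mulRight_apply, bimod_left, bimod_right,
          Algebra.TensorProduct.tmul_mul_tmul, mul_assoc] using this
      | add u v hu hv =>
        simp only [LinearMap.comp_apply, LinearMap.mulRight_apply, mul_add, map_add] at hu hv ⊢
        rw [hu, hv])

/-- If `t (β(a) ⊗ 1 - 1 ⊗ α(a)) = 0` for all `a`, then `u ↦ t u` descends from `H ⊗_k H` to
`H ⊗_R H`. -/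
def mulOn (S : SourceTarget k R H) (t : S.HH)
    (ht : ∀ a : R, S.rightMul (S.target (MulOpposite.op a) ⊗ₜ[k] 1 - 1 ⊗ₜ[k] S.source a) t = 0) :
    S.HH →ₗ[k] S.HH :=
  lift S.bimod S.bimod
    { toFun := fun u => S.rightMul u t
      map_add' := fun u v => by
        have : S.rightMul (u + v) = S.rightMul u + S.rightMul v :=
          tens_ext fun m n => by simp [rightMul, mul_add]
        rw [this]; rfl
      map_smul' := fun c u => by
        have : S.rightMul (c • u) = c • S.rightMul u :=
          tens_ext fun m n => by simp [rightMul]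
        rw [this]; rfl }
    (fun a x y => by
      have key : ∀ u v : H ⊗[k] H, S.rightMul (u * v) = S.rightMul v ∘ₗ S.rightMul u :=
        fun u v => tens_ext fun m n => by
          change (relations S.bimod S.bimod).mkQ _ = (relations S.bimod S.bimod).mkQ _
          simp [mul_assoc]
      have hsub : ∀ u v : H ⊗[k] H, S.rightMul (u - v) = S.rightMul u - S.rightMul v :=
        fun u v => tens_ext fun m n => by simp [rightMul, mul_sub]
      have h := congrArg (S.rightMul (x ⊗ₜ[k] y)) (ht a)
      rw [← LinearMap.comp_apply, ← key, sub_mul, hsub, map_zero, LinearMap.sub_apply,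
        sub_eq_zero] at h
      simp only [Algebra.TensorProduct.tmul_mul_tmul, one_mul] at h
      exact h)

end SourceTarget

/-- A Hopf algebroid over the base algebra `R` (no antipode is required). -/
structure HopfAlgebroid (k R H : Type*) [CommRing k] [Ring R] [Algebra k R]
    [Ring H] [Algebra k H] extends SourceTarget k R H where
  /-- the coproduct, a bimodule map -/
  comul : H →ₗ[k] toSourceTarget.HH
  comul_isHom : IsHom toSourceTarget.bimod (tens toSourceTarget.bimod toSourceTarget.bimod) comul
  comul_one : comul 1 = tmul toSourceTarget.bimod toSourceTarget.bimod 1 1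
  /-- `(Δ ⊗_R id) Δ = (id ⊗_R Δ) Δ` -/
  coassoc : ∀ h : H,
    assoc toSourceTarget.bimod toSourceTarget.bimod toSourceTarget.bimod
      (map comul comul_isHom LinearMap.id (isHom_id _) (comul h)) =
    map LinearMap.id (isHom_id _) comul comul_isHom (comul h)
  /-- `Δ(h) (β(a) ⊗ 1 - 1 ⊗ α(a)) = 0` -/
  comul_rightMul : ∀ (h : H) (a : R),
    toSourceTarget.rightMul (target (MulOpposite.op a) ⊗ₜ[k] 1 - 1 ⊗ₜ[k] source a) (comul h) = 0
  /-- `Δ(h₁ h₂) = Δ(h₁) Δ(h₂)` -/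
  comul_mul : ∀ h₁ h₂ : H,
    comul (h₁ * h₂) = toSourceTarget.mulOn (comul h₁) (comul_rightMul h₁) (comul h₂)
  /-- the counit, a bimodule map -/
  counit : H →ₗ[k] R
  counit_isHom : IsHom toSourceTarget.bimod (regular k R) counit
  counit_one : counit 1 = 1
  /-- `(ε ⊗_R id) Δ = id`, with `R ⊗_R H = H` -/
  counit_comul : ∀ h : H,
    lid toSourceTarget.bimod (map counit counit_isHom LinearMap.id (isHom_id _) (comul h)) = h
  /-- `(id ⊗_R ε) Δ = id`, with `H ⊗_R R = H` -/
  comul_counit : ∀ h : H,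
    rid toSourceTarget.bimod (map LinearMap.id (isHom_id _) counit counit_isHom (comul h)) = h

namespace HopfAlgebroid

variable {k R H : Type*} [CommRing k] [Ring R] [Algebra k R] [Ring H] [Algebra k H]

/-- The flip `x ⊗ y ↦ y ⊗ x` of `H ⊗_R H`, defined when the source and target maps coincide. -/
def flip (𝓗 : HopfAlgebroid k R H) (h : ∀ a, 𝓗.source a = 𝓗.target (MulOpposite.op a)) :
    𝓗.HH →ₗ[k] 𝓗.HH :=
  lift 𝓗.bimod 𝓗.bimod
    ((relations 𝓗.bimod 𝓗.bimod).mkQ ∘ₗ (TensorProduct.comm k H H).toLinearMap)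
    (fun a x y => by
      have := tmul_balanced 𝓗.bimod 𝓗.bimod a y x
      simpa only [tmul, LinearMap.comp_apply, SourceTarget.bimod_left, SourceTarget.bimod_right,
        ← h, LinearEquiv.coe_coe, TensorProduct.comm_tmul] using this.symm)

/-- `Δᵒᵖ = Δ`; this includes that the source and target maps coincide. -/
def IsCocommutative (𝓗 : HopfAlgebroid k R H) : Prop :=
  ∃ h : ∀ a, 𝓗.source a = 𝓗.target (MulOpposite.op a),
    ∀ x, 𝓗.flip h (𝓗.comul x) = 𝓗.comul x

/-- For a bimodule map `μ : H → End_k R`, the map `x ⊗ y ↦ x(a) · y`, where `x(a) = μ x a`. -/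
def phiSource (𝓗 : HopfAlgebroid k R H) (μ : H →ₗ[k] Module.End k R)
    (hμ : IsHom 𝓗.bimod (endBimodule k R) μ) (a : R) : 𝓗.HH →ₗ[k] H :=
  lift 𝓗.bimod 𝓗.bimod
    (TensorProduct.lift
      (𝓗.bimod.left.toLinearMap ∘ₗ LinearMap.applyₗ (R := k) a ∘ₗ μ))
    (fun b x y => by
      have h : μ (𝓗.target (MulOpposite.op b) * x) a = μ x a * b :=
        LinearMap.congr_fun (hμ.map_right (MulOpposite.op b) x) a
      simp [h])

/-- For a bimodule map `μ : H → End_k R`, the map `x ⊗ y ↦ x · y(a)`, where `y(a) = μ y a`. -/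
def phiTarget (𝓗 : HopfAlgebroid k R H) (μ : H →ₗ[k] Module.End k R)
    (hμ : IsHom 𝓗.bimod (endBimodule k R) μ) (a : R) : 𝓗.HH →ₗ[k] H :=
  lift 𝓗.bimod 𝓗.bimod
    (TensorProduct.lift
      (𝓗.bimod.right.toLinearMap ∘ₗ (MulOpposite.opLinearEquiv k : R ≃ₗ[k] Rᵐᵒᵖ).toLinearMap ∘ₗ
        LinearMap.applyₗ (R := k) a ∘ₗ μ).flip)
    (fun b x y => by
      have h : μ (𝓗.source b * y) a = b * μ y a :=
        LinearMap.congr_fun (hμ.map_left b y) a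
      simp [h])

/-- An anchor of a Hopf algebroid: a representation of `H` on `R` with the stated properties. -/
structure IsAnchor (𝓗 : HopfAlgebroid k R H) (μ : H →ₐ[k] Module.End k R) : Prop where
  isHom : IsHom 𝓗.bimod (endBimodule k R) μ.toLinearMap
  phiSource_comul : ∀ (x : H) (a : R),
    𝓗.phiSource μ.toLinearMap isHom a (𝓗.comul x) = x * 𝓗.source a
  phiTarget_comul : ∀ (x : H) (a : R),
    𝓗.phiTarget μ.toLinearMap isHom a (𝓗.comul x) = x * 𝓗.target (MulOpposite.op a)
  apply_one : ∀ x : H, μ x 1 = 𝓗.counit x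

end HopfAlgebroid

/-! ### Smooth functions, vector fields and sections -/

section Geometry

variable {E : Type*} [NormedAddCommGroup E] [NormedSpace ℝ E] {H : Type*} [TopologicalSpace H]
  {I : ModelWithCorners ℝ E H} {P : Type*} [TopologicalSpace P] [ChartedSpace H P]

/-- The pointwise product makes the smooth sections of a vector bundle a module over the smooth
functions. -/
instance ContMDiffSection.instModuleSmooth {F : Type*} [NormedAddCommGroup F] [NormedSpace ℝ F]
    {V : P → Type*} [TopologicalSpace (Bundle.TotalSpace F V)] [∀ p, TopologicalSpace (V p)]
    [FiberBundle F V] [∀ p, AddCommGroup (V p)] [∀ p, Module ℝ (V p)] [VectorBundle ℝ F V] :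
    Module C^∞⟮I, P; 𝓘(ℝ, ℝ), ℝ⟯ Cₛ^∞⟮I; F, V⟯ where
  smul f X := ⟨fun p => f p • X p, f.contMDiff.smul_section X.contMDiff⟩
  one_smul X := ContMDiffSection.ext fun p => one_smul ℝ (X p)
  mul_smul f g X := ContMDiffSection.ext fun p => mul_smul (f p) (g p) (X p)
  smul_zero f := ContMDiffSection.ext fun p => smul_zero (f p)
  smul_add f X Y := ContMDiffSection.ext fun p => smul_add (f p) (X p) (Y p)
  add_smul f g X := ContMDiffSection.ext fun p => add_smul (f p) (g p) (X p)
  zero_smul X := ContMDiffSection.ext fun p => zero_smul ℝ (X p)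

theorem ContMDiffSection.smooth_smul_apply {F : Type*} [NormedAddCommGroup F] [NormedSpace ℝ F]
    {V : P → Type*} [TopologicalSpace (Bundle.TotalSpace F V)] [∀ p, TopologicalSpace (V p)]
    [FiberBundle F V] [∀ p, AddCommGroup (V p)] [∀ p, Module ℝ (V p)] [VectorBundle ℝ F V]
    (f : C^∞⟮I, P; 𝓘(ℝ, ℝ), ℝ⟯) (X : Cₛ^∞⟮I; F, V⟯) (p : P) : (f • X) p = f p • X p := rfl

variable [IsManifold I ∞ P]

theorem contMDiff_mvfderiv_apply (X : Cₛ^∞⟮I; E, (TangentSpace I : P → Type _)⟯)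
    (f : C^∞⟮I, P; 𝓘(ℝ, ℝ), ℝ⟯) :
    ContMDiff I 𝓘(ℝ, ℝ) ∞ (fun p => mvfderiv I f p (X p)) :=
  (contMDiff_snd_tangentBundle_modelSpace ℝ 𝓘(ℝ, ℝ)).comp
    ((f.contMDiff.contMDiff_tangentMap (m := ∞) le_rfl).comp X.contMDiff)

/-- The derivation `f ↦ X f` of the algebra of smooth functions given by a smooth vector field,
`(X f)(p) = df_p(X_p)`. -/
def vectorFieldDerivation (X : Cₛ^∞⟮I; E, (TangentSpace I : P → Type _)⟯) :
    Derivation ℝ C^∞⟮I, P; 𝓘(ℝ, ℝ), ℝ⟯ C^∞⟮I, P; 𝓘(ℝ, ℝ), ℝ⟯ :=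
  Derivation.mk'
    { toFun := fun f => ⟨fun p => mvfderiv I f p (X p), contMDiff_mvfderiv_apply X f⟩
      map_add' := fun f g => ContMDiffMap.ext fun p => by
        have h := mvfderiv_add (I := I) (f.contMDiff.mdifferentiableAt (x := p) (by simp))
          (g.contMDiff.mdifferentiableAt (x := p) (by simp))
        exact congrArg (fun L => L (X p)) h
      map_smul' := fun c f => ContMDiffMap.ext fun p => by
        have h := mvfderiv_smul (I := I) (x := p) (a := fun _ => c) mdifferentiableAt_const
          (f.contMDiff.mdifferentiableAt (x := p) (by simp))
        rw [mvfderiv_const] at h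
        have h' := congrArg (fun L => L (X p)) h
        simp at h'
        exact h' }
    (fun f g => ContMDiffMap.ext fun p => by
      have h := mvfderiv_mul (I := I) (f.contMDiff.mdifferentiableAt (x := p) (by simp))
          (g.contMDiff.mdifferentiableAt (x := p) (by simp))
      exact congrArg (fun L => L (X p)) h)

theorem vectorFieldDerivation_apply (X : Cₛ^∞⟮I; E, (TangentSpace I : P → Type _)⟯)
    (f : C^∞⟮I, P; 𝓘(ℝ, ℝ), ℝ⟯) (p : P) :
    vectorFieldDerivation X f p = mvfderiv I f p (X p) := rfl

variable (I P) in
/-- The algebra of differential operators on `P`, as the algebra of endomorphisms of the space of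
smooth functions generated by the smooth functions (acting by multiplication) and the smooth
vector fields. -/
def diffOperators : Subalgebra ℝ (Module.End ℝ C^∞⟮I, P; 𝓘(ℝ, ℝ), ℝ⟯) :=
  Algebra.adjoin ℝ
    (Set.range (Algebra.lmul ℝ C^∞⟮I, P; 𝓘(ℝ, ℝ), ℝ⟯) ∪
      Set.range fun X : Cₛ^∞⟮I; E, (TangentSpace I : P → Type _)⟯ =>
        (vectorFieldDerivation X).toLinearMap)

/-- The Lie bracket of vector fields acts on smooth functions as the commutator. -/
theorem mvfderiv_mlieBracket [CompleteSpace E]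
    (X Y : Cₛ^∞⟮I; E, (TangentSpace I : P → Type _)⟯) (f : C^∞⟮I, P; 𝓘(ℝ, ℝ), ℝ⟯) (p : P) :
    mvfderiv I f p (VectorField.mlieBracket I X Y p) =
      vectorFieldDerivation X (vectorFieldDerivation Y f) p -
        vectorFieldDerivation Y (vectorFieldDerivation X f) p := by
  by_cases hE : ∀ v : TangentSpace I p, v = 0
  · rw [vectorFieldDerivation_apply, vectorFieldDerivation_apply, hE (X p), hE (Y p),
      hE (VectorField.mlieBracket I X Y p)]
    simp
  push Not at hE
  obtain ⟨z, hz⟩ := hE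
  have : IsManifold I (minSmoothness ℝ 3) P := IsManifold.of_le (n := ∞) (by
    simpa using (ENat.LEInfty.out : (3 : WithTop ℕ∞) ≤ ∞))
  have : IsManifold I 2 P := IsManifold.of_le (n := ∞) ENat.LEInfty.out
  have : IsManifold I (∞ + 1) P := ‹IsManifold I ∞ P›
  set Z : Π q : P, TangentSpace I q := FiberBundle.extend E z with hZdef
  obtain ⟨s, hs, hZs⟩ := FiberBundle.exists_contMDiffOn_extend (k := ∞) I E z
  have hZ : ∀ᶠ q in nhds p, ContMDiffAt I I.tangent ∞ (fun q => (⟨q, Z q⟩ : TangentBundle I P)) q := by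
    filter_upwards [eventually_mem_nhds_iff.2 hs] with q hq
    exact hZs.contMDiffAt hq
  have hZp : Z p = z := FiberBundle.extend_apply_self ..
  have key : ∀ (U W : Cₛ^∞⟮I; E, (TangentSpace I : P → Type _)⟯),
      VectorField.mlieBracket I U (VectorField.mlieBracket I W ((f : P → ℝ) • Z)) p =
        vectorFieldDerivation U (vectorFieldDerivation W f) p • Z p +
        vectorFieldDerivation W f p • VectorField.mlieBracket I U Z p +
        (vectorFieldDerivation U f p • VectorField.mlieBracket I W Z p +
        f p • VectorField.mlieBracket I U (VectorField.mlieBracket I W Z) p) := by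
    intro U W
    have e : VectorField.mlieBracket I W ((f : P → ℝ) • Z) =ᶠ[nhds p]
        ((vectorFieldDerivation W f : P → ℝ) • Z + (f : P → ℝ) • VectorField.mlieBracket I W Z) := by
      filter_upwards [hZ] with q hq
      rw [VectorField.mlieBracket_smul_right (f.contMDiff.mdifferentiableAt (by simp))
        (hq.mdifferentiableAt (by simp))]
      rfl
    have hZ0 := hZ.self_of_nhds
    have hWZ : ContMDiffAt I I.tangent ∞
        (fun q => (⟨q, VectorField.mlieBracket I W Z q⟩ : TangentBundle I P)) p :=
      ContMDiffAt.mlieBracket_vectorField (m := ⊤) (n := ⊤) (W.contMDiff p) hZ0 (by simp)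
    have hg := (vectorFieldDerivation W f).contMDiff p
    have hf := f.contMDiff p
    rw [Filter.EventuallyEq.rfl.mlieBracket_vectorField_eq e,
      VectorField.mlieBracket_add_right ((hg.smul_section hZ0).mdifferentiableAt (by simp))
        ((hf.smul_section hWZ).mdifferentiableAt (by simp)),
      VectorField.mlieBracket_smul_right (hg.mdifferentiableAt (by simp))
        (hZ0.mdifferentiableAt (by simp)),
      VectorField.mlieBracket_smul_right (hf.mdifferentiableAt (by simp))
        (hWZ.mdifferentiableAt (by simp))]
    rfl
  have hZ0 := hZ.self_of_nhds
  have hf := f.contMDiff p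
  have two : (minSmoothness ℝ 2) ≤ (∞ : WithTop ℕ∞) := by
    simpa using (ENat.LEInfty.out : (2 : WithTop ℕ∞) ≤ ∞)
  have J := VectorField.leibniz_identity_mlieBracket_apply (I := I) (x := p)
    ((X.contMDiff p).of_le two) ((Y.contMDiff p).of_le two) ((hf.smul_section hZ0).of_le two)
  have J' := VectorField.leibniz_identity_mlieBracket_apply (I := I) (x := p)
    ((X.contMDiff p).of_le two) ((Y.contMDiff p).of_le two) (hZ0.of_le two)
  rw [key X Y, key Y X, VectorField.mlieBracket_smul_right (hf.mdifferentiableAt (by simp))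
        (hZ0.mdifferentiableAt (by simp)), J', hZp] at J
  have hJ : (mvfderiv I f p (VectorField.mlieBracket I X Y p) -
      (vectorFieldDerivation X (vectorFieldDerivation Y f) p -
        vectorFieldDerivation Y (vectorFieldDerivation X f) p)) • z = 0 := by
    rw [← sub_eq_zero] at J
    rw [← neg_eq_zero, ← J]
    module
  exact sub_eq_zero.1 ((smul_eq_zero.1 hJ).resolve_right hz)

end Geometry

/-! ### Universal enveloping algebras of Lie-Rinehart algebras -/

namespace LieRinehart

section UEA

attribute [local instance] LieRing.ofAssociativeRing

variable (k R L : Type*) [CommRing k] [CommRing R] [Algebra k R] [LieRing L] [LieAlgebra k L]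
  [Module R L] [LieRingModule L R] [LieRinehartRing R L] [LieRinehartAlgebra k R L]

/-- The action of `L` on `R`, seen as an abelian Lie algebra. -/
def action : L →ₗ⁅k⁆ LieDerivation k R R where
  toFun X :=
    { toLinearMap := LieModule.toEnd k L R X
      leibniz' := fun f g => by simp [LieRing.of_associative_ring_bracket, mul_comm] }
  map_add' X Y := by ext f; simp
  map_smul' c X := by ext f; simp
  map_lie' := by intro X Y; ext f; simp

/-- The `k`-Lie algebra `R ⊕ L`, with bracket `[f + X, g + Y] = (X g - Y f) + [X, Y]`. -/
abbrev SumLie : Type _ := LieAlgebra.SemiDirectSum R L (action k R L)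

variable {k R L} in
theorem sumLie_lie (f g : R) (X Y : L) :
    ⁅(⟨f, X⟩ : SumLie k R L), (⟨g, Y⟩ : SumLie k R L)⁆ = ⟨⁅X, g⁆ - ⁅Y, f⁆, ⁅X, Y⁆⟩ := by
  rw [LieAlgebra.SemiDirectSum.lie_eq_mk]
  simp [action, LieRing.of_associative_ring_bracket, mul_comm]

/-- The image `f'` of `f : R` in `U(R ⊕ L)`. -/
def ofFun (f : R) : UniversalEnvelopingAlgebra k (SumLie k R L) :=
  UniversalEnvelopingAlgebra.ι k (LieAlgebra.SemiDirectSum.inl (action k R L) f)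

/-- The image `X'` of `X : L` in `U(R ⊕ L)`. -/
def ofSec (X : L) : UniversalEnvelopingAlgebra k (SumLie k R L) :=
  UniversalEnvelopingAlgebra.ι k (LieAlgebra.SemiDirectSum.inr (action k R L) X)

/-- The relations `(f g)' = f' g'`, `(f X)' = f' X'` and `1' = 1`. -/
inductive Rel : UniversalEnvelopingAlgebra k (SumLie k R L) →
    UniversalEnvelopingAlgebra k (SumLie k R L) → Prop
  | one : Rel (ofFun k R L 1) 1
  | mul (f g : R) : Rel (ofFun k R L (f * g)) (ofFun k R L f * ofFun k R L g)
  | smul (f : R) (X : L) : Rel (ofSec k R L (f • X)) (ofFun k R L f * ofSec k R L X)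

/-- The universal enveloping algebra: the quotient of `U(R ⊕ L)` by the two-sided ideal generated
by the differences of the two sides of the relations. -/
def UEA : Type _ := RingQuot (Rel k R L)

instance : Ring (UEA k R L) := inferInstanceAs (Ring (RingQuot (Rel k R L)))

instance : Algebra k (UEA k R L) := inferInstanceAs (Algebra k (RingQuot (Rel k R L)))

/-- The quotient map `U(R ⊕ L) → UEA`. -/
def mk : UniversalEnvelopingAlgebra k (SumLie k R L) →ₐ[k] UEA k R L := RingQuot.mkAlgHom k (Rel k R L)

/-- The canonical map `R → UEA`. -/
def ι₁ : R →ₐ[k] UEA k R L :=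
  AlgHom.ofLinearMap
    ((mk k R L).toLinearMap ∘ₗ (UniversalEnvelopingAlgebra.ι k : SumLie k R L →ₗ⁅k⁆ _).toLinearMap ∘ₗ
      (LieAlgebra.SemiDirectSum.inl (action k R L)).toLinearMap)
    ((RingQuot.mkAlgHom_rel k Rel.one).trans (map_one (mk k R L)))
    (fun f g => (RingQuot.mkAlgHom_rel k (Rel.mul f g)).trans (map_mul (mk k R L) _ _))

/-- The canonical map `L → UEA`. -/
def ι₂ : L →ₗ[k] UEA k R L :=
  (mk k R L).toLinearMap ∘ₗ (UniversalEnvelopingAlgebra.ι k : SumLie k R L →ₗ⁅k⁆ _).toLinearMap ∘ₗ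
    (LieAlgebra.SemiDirectSum.inr (action k R L)).toLinearMap

end UEA

end LieRinehart

/-! ### Lie algebroids -/

section Algebroid

variable {E : Type*} [NormedAddCommGroup E] [NormedSpace ℝ E] {H : Type*} [TopologicalSpace H]
  (I : ModelWithCorners ℝ E H) {P : Type*} [TopologicalSpace P] [ChartedSpace H P]
  [IsManifold I ∞ P]
  (F : Type*) [NormedAddCommGroup F] [NormedSpace ℝ F]
  (V : P → Type*) [TopologicalSpace (Bundle.TotalSpace F V)] [∀ p, TopologicalSpace (V p)]
  [FiberBundle F V] [∀ p, AddCommGroup (V p)] [∀ p, Module ℝ (V p)] [VectorBundle ℝ F V]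

/-- A smooth bundle map `V → TP` over the identity of `P`, linear on the fibres. -/
structure BundleAnchor where
  toFun : ∀ p, V p →ₗ[ℝ] TangentSpace I p
  contMDiff_toFun : ContMDiff (I.prod 𝓘(ℝ, F)) I.tangent ∞
    (fun v : Bundle.TotalSpace F V => (⟨v.proj, toFun v.proj v.2⟩ : TangentBundle I P))

variable {I F V} in
/-- The map on sections induced by a bundle map `V → TP`. -/
def BundleAnchor.onSections (ρ : BundleAnchor I F V) (X : Cₛ^∞⟮I; F, V⟯) :
    Cₛ^∞⟮I; E, (TangentSpace I : P → Type _)⟯ :=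
  ⟨fun p => ρ.toFun p (X p), ρ.contMDiff_toFun.comp X.contMDiff⟩

/-- A Lie algebroid structure on the smooth vector bundle `V → P` (with typical fibre `F`). -/
structure LieAlgebroid where
  /-- the Lie bracket of smooth sections -/
  bracket : Cₛ^∞⟮I; F, V⟯ →ₗ[ℝ] Cₛ^∞⟮I; F, V⟯ →ₗ[ℝ] Cₛ^∞⟮I; F, V⟯
  bracket_self : ∀ X, bracket X X = 0
  jacobi : ∀ X Y Z, bracket X (bracket Y Z) = bracket (bracket X Y) Z + bracket Y (bracket X Z)
  anchor : BundleAnchor I F V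
  anchor_bracket : ∀ X Y p, anchor.onSections (bracket X Y) p =
    VectorField.mlieBracket I (anchor.onSections X) (anchor.onSections Y) p
  leibniz : ∀ X Y (f : C^∞⟮I, P; 𝓘(ℝ, ℝ), ℝ⟯),
    bracket X (f • Y) = f • bracket X Y + vectorFieldDerivation (anchor.onSections X) f • Y

namespace LieAlgebroid

variable {I F V} (A : LieAlgebroid I F V)

/-- The space of smooth sections of `A`, equipped below with its Lie-Rinehart algebra structure. -/
def Sec (_ : LieAlgebroid I F V) : Type _ := Cₛ^∞⟮I; F, V⟯

instance : AddCommGroup A.Sec := inferInstanceAs (AddCommGroup Cₛ^∞⟮I; F, V⟯)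

instance : Module ℝ A.Sec := inferInstanceAs (Module ℝ Cₛ^∞⟮I; F, V⟯)

instance : Module C^∞⟮I, P; 𝓘(ℝ, ℝ), ℝ⟯ A.Sec :=
  inferInstanceAs (Module C^∞⟮I, P; 𝓘(ℝ, ℝ), ℝ⟯ Cₛ^∞⟮I; F, V⟯)

instance : LieRing A.Sec where
  bracket X Y := A.bracket X Y
  add_lie X Y Z := A.bracket.map_add₂ X Y Z
  lie_add X Y Z := map_add (A.bracket X) Y Z
  lie_self X := A.bracket_self X
  leibniz_lie X Y Z := A.jacobi X Y Z

instance : LieAlgebra ℝ A.Sec where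
  lie_smul c X Y := map_smul (A.bracket X) c Y

/-- The derivation of the algebra of smooth functions given by the anchor. -/
def anchorDerivation (X : A.Sec) :
    Derivation ℝ C^∞⟮I, P; 𝓘(ℝ, ℝ), ℝ⟯ C^∞⟮I, P; 𝓘(ℝ, ℝ), ℝ⟯ :=
  vectorFieldDerivation (A.anchor.onSections X)

theorem anchorDerivation_apply (X : A.Sec) (f : C^∞⟮I, P; 𝓘(ℝ, ℝ), ℝ⟯) (p : P) :
    A.anchorDerivation X f p = mvfderiv I f p (A.anchor.toFun p (DFunLike.coe (F := Cₛ^∞⟮I; F, V⟯) X p)) := rfl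

variable [FiniteDimensional ℝ E]

/-- Sections act on smooth functions through the anchor. -/
instance : LieRingModule A.Sec C^∞⟮I, P; 𝓘(ℝ, ℝ), ℝ⟯ where
  bracket X f := A.anchorDerivation X f
  add_lie X Y f := ContMDiffMap.ext fun p =>
    ((mvfderiv I f p).congr_arg (map_add (A.anchor.toFun p) _ _)).trans (map_add (mvfderiv I f p) _ _)
  lie_add X f g := map_add (A.anchorDerivation X) f g
  leibniz_lie X Y f := ContMDiffMap.ext fun p => by
    have : CompleteSpace E := FiniteDimensional.complete ℝ E
    have h := mvfderiv_mlieBracket (A.anchor.onSections X) (A.anchor.onSections Y) f p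
    rw [← A.anchor_bracket X Y p] at h
    exact (sub_eq_iff_eq_add.1 h.symm)

instance : LieRinehartRing C^∞⟮I, P; 𝓘(ℝ, ℝ), ℝ⟯ A.Sec where
  lie_smul_eq_mul' _ g _ := ContMDiffMap.ext fun p =>
    ((mvfderiv I g p).congr_arg (map_smul (A.anchor.toFun p) _ _)).trans
      (map_smul (mvfderiv I g p) _ _)
  leibniz_mul_right' X f g :=
    ((A.anchorDerivation X).leibniz f g).trans (congrArg _ (mul_comm _ _))
  leibniz_smul_right' X Y f := A.leibniz X Y f

instance : LieRinehartAlgebra ℝ C^∞⟮I, P; 𝓘(ℝ, ℝ), ℝ⟯ A.Sec where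
  smul_assoc c f X := ContMDiffSection.ext fun p => smul_assoc c (f p) (DFunLike.coe (F := Cₛ^∞⟮I; F, V⟯) X p)
  smul_lie _ _ f := ContMDiffMap.ext fun p =>
    ((mvfderiv I f p).congr_arg (map_smul (A.anchor.toFun p) _ _)).trans
      (map_smul (mvfderiv I f p) _ _)
  lie_smul c X f := (A.anchorDerivation X).map_smul c f

/-- The universal enveloping algebra `UA` of a Lie algebroid. -/
abbrev UA : Type _ := LieRinehart.UEA ℝ C^∞⟮I, P; 𝓘(ℝ, ℝ), ℝ⟯ A.Sec

/-- The canonical map `C^∞(P) → UA`. -/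
def i₁ : C^∞⟮I, P; 𝓘(ℝ, ℝ), ℝ⟯ →ₐ[ℝ] A.UA := LieRinehart.ι₁ ℝ C^∞⟮I, P; 𝓘(ℝ, ℝ), ℝ⟯ A.Sec

/-- The canonical map `Γ(A) → UA`. -/
def i₂ : A.Sec →ₗ[ℝ] A.UA := LieRinehart.ι₂ ℝ C^∞⟮I, P; 𝓘(ℝ, ℝ), ℝ⟯ A.Sec

end LieAlgebroid

end Algebroid

end

/-!
The argument is algebraic: it applies to the universal enveloping algebra `U` of any Lie-Rinehart
algebra `(R, L)`, and no basis theorem of Poincaré-Birkhoff-Witt type is needed.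

By its universal property (`UEA.lift`), `U` acts on `R`, functions by multiplication and sections as
derivations (`anchorRep`). As `f` sends `1` to `f`, the map `ι₁` is injective. The counit is
`ε(u) = u(1)`; it kills the left ideal generated by the sections, and `u - ε(u)` lies in this ideal
by induction on `u`, which determines the kernel.

The tensor product over `R` of two `U`-modules is again a `U`-module, with
`X (m ⊗ n) = X m ⊗ n + m ⊗ X n` (`tensRep`). In particular `U` acts on `U ⊗_R U`, and the coproduct is
`Δ(u) = u · (1 ⊗ 1)`. Right multiplications on `U ⊗_R U` commute with this action, whence
`Δ(u) (f ⊗ 1 - 1 ⊗ f) = u · (f ⊗ 1 - 1 ⊗ f) = 0`, and multiplication by `Δ(u)` is the action of `u`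
(`mulOn_comul`); so `Δ` is multiplicative. In each of the remaining axioms (coassociativity, the
counit identities, invariance under the flip, the anchor identities) both sides are maps of `U`-modules
with source `U`, so they agree because they agree at `1` (`apply_comul`).
-/

/-! ### The universal property of the universal enveloping algebra -/

namespace LieRinehart

attribute [local instance 100] LieRing.ofAssociativeRing

section UniversalProperty

variable {k R L : Type*} [CommRing k] [CommRing R] [Algebra k R] [LieRing L] [LieAlgebra k L]
  [Module R L] [LieRingModule L R] [LieRinehartRing R L] [LieRinehartAlgebra k R L]

theorem ι₂_smul (f : R) (X : L) : ι₂ k R L (f • X) = ι₁ k R L f * ι₂ k R L X :=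
  (RingQuot.mkAlgHom_rel k (Rel.smul f X)).trans (map_mul (mk k R L) _ _)

/-- The commutation rule `X f = f X + X(f)` in the universal enveloping algebra. -/
theorem ι₂_mul_ι₁ (X : L) (f : R) :
    ι₂ k R L X * ι₁ k R L f = ι₁ k R L f * ι₂ k R L X + ι₁ k R L ⁅X, f⁆ := by
  have h : (⁅(⟨0, X⟩ : SumLie k R L), (⟨f, 0⟩ : SumLie k R L)⁆) = ⟨⁅X, f⁆, 0⟩ := by
    rw [sumLie_lie]; simp
  have h' := congrArg (fun t => mk k R L (UniversalEnvelopingAlgebra.ι k t)) h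
  simp only [LieHom.map_lie, LieRing.of_associative_ring_bracket, map_sub, map_mul] at h'
  exact sub_eq_iff_eq_add'.1 h'

theorem ι₂_lie (X Y : L) :
    ι₂ k R L ⁅X, Y⁆ = ι₂ k R L X * ι₂ k R L Y - ι₂ k R L Y * ι₂ k R L X := by
  have h : (⁅(⟨0, X⟩ : SumLie k R L), (⟨0, Y⟩ : SumLie k R L)⁆) = ⟨0, ⁅X, Y⁆⟩ := by
    rw [sumLie_lie]; simp
  have h' := congrArg (fun t => mk k R L (UniversalEnvelopingAlgebra.ι k t)) h
  simp only [LieHom.map_lie, LieRing.of_associative_ring_bracket, map_sub, map_mul] at h'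
  exact h'.symm

variable {B : Type*} [Ring B] [Algebra k B]

/-- The Lie algebra homomorphism `f + X ↦ α f + φ X` on `R ⊕ L`. -/
def sumLieHom (α : R →ₐ[k] B) (φ : L →ₗ⁅k⁆ B) (h : ∀ X f, φ X * α f = α f * φ X + α ⁅X, f⁆) :
    SumLie k R L →ₗ⁅k⁆ B where
  toFun x := α x.left + φ x.right
  map_add' x y := by simp; abel
  map_smul' c x := by simp
  map_lie' {x y} := by
    obtain ⟨f, X⟩ := x
    obtain ⟨g, Y⟩ := y
    have hc : α f * α g = α g * α f := by rw [← map_mul, mul_comm, map_mul]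
    rw [sumLie_lie]
    simp only [map_sub, LieHom.map_lie, LieRing.of_associative_ring_bracket, add_mul, mul_add, h, hc]
    abel

/-- The universal property of the universal enveloping algebra. -/
def UEA.lift (α : R →ₐ[k] B) (φ : L →ₗ⁅k⁆ B) (h : ∀ X f, φ X * α f = α f * φ X + α ⁅X, f⁆)
    (h' : ∀ f X, φ (f • X) = α f * φ X) : UEA k R L →ₐ[k] B :=
  RingQuot.liftAlgHom k ⟨UniversalEnvelopingAlgebra.lift k (sumLieHom α φ h), by
    intro x y hxy
    cases hxy <;>
    simp [ofFun, ofSec, sumLieHom, h']⟩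

@[simp]
theorem UEA.lift_ι₁ (α : R →ₐ[k] B) (φ : L →ₗ⁅k⁆ B)
    (h : ∀ X f, φ X * α f = α f * φ X + α ⁅X, f⁆) (h' : ∀ f X, φ (f • X) = α f * φ X) (f : R) :
    UEA.lift α φ h h' (ι₁ k R L f) = α f := by
  refine (RingQuot.liftAlgHom_mkAlgHom_apply k _ _ _).trans ?_
  simp [sumLieHom]

@[simp]
theorem UEA.lift_ι₂ (α : R →ₐ[k] B) (φ : L →ₗ⁅k⁆ B)
    (h : ∀ X f, φ X * α f = α f * φ X + α ⁅X, f⁆) (h' : ∀ f X, φ (f • X) = α f * φ X) (X : L) :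
    UEA.lift α φ h h' (ι₂ k R L X) = φ X := by
  refine (RingQuot.liftAlgHom_mkAlgHom_apply k _ _ _).trans ?_
  simp [sumLieHom]

theorem UEA.hom_ext {f g : UEA k R L →ₐ[k] B} (h₁ : ∀ a, f (ι₁ k R L a) = g (ι₁ k R L a))
    (h₂ : ∀ X, f (ι₂ k R L X) = g (ι₂ k R L X)) : f = g := by
  refine RingQuot.ringQuot_ext' k f g (UniversalEnvelopingAlgebra.hom_ext k (LieHom.ext ?_))
  rintro ⟨a, X⟩
  have e : (⟨a, X⟩ : SumLie k R L) = LieAlgebra.SemiDirectSum.inl (action k R L) a +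
      LieAlgebra.SemiDirectSum.inr (action k R L) X := by simp
  rw [e, map_add, map_add]
  exact congrArg₂ (· + ·) (h₁ a) (h₂ X)

/-- The universal enveloping algebra `U` is generated by `R` and `L`: by the universal property,
the identity of `U` factors through the subalgebra they generate. -/
theorem UEA.adjoin_eq_top :
    Algebra.adjoin k (Set.range (ι₁ k R L) ∪ Set.range (ι₂ k R L)) = ⊤ := by
  set S := Algebra.adjoin k (Set.range (ι₁ k R L) ∪ Set.range (ι₂ k R L))
  have m₁ : ∀ f, ι₁ k R L f ∈ S := fun f => Algebra.subset_adjoin (Or.inl ⟨f, rfl⟩)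
  have m₂ : ∀ X, ι₂ k R L X ∈ S := fun X => Algebra.subset_adjoin (Or.inr ⟨X, rfl⟩)
  let φ : L →ₗ⁅k⁆ S :=
    { (ι₂ k R L).codRestrict S.toSubmodule m₂ with
      map_lie' := fun {X Y} => Subtype.ext (ι₂_lie X Y) }
  let F : UEA k R L →ₐ[k] S := UEA.lift ((ι₁ k R L).codRestrict S m₁) φ
    (fun X f => Subtype.ext (ι₂_mul_ι₁ X f)) (fun f X => Subtype.ext (ι₂_smul f X))
  have hF : S.val.comp F = AlgHom.id k _ := by
    refine UEA.hom_ext (fun a => ?_) fun X => ?_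
    · exact congrArg Subtype.val (UEA.lift_ι₁ (B := S) _ _ _ _ a)
    · exact congrArg Subtype.val (UEA.lift_ι₂ (B := S) _ _ _ _ X)
  refine Algebra.eq_top_iff.2 fun x => ?_
  rw [show x = (F x : UEA k R L) from (DFunLike.congr_fun hF x).symm]
  exact (F x).2

/-- Induction on the universal enveloping algebra by left multiplication with generators. -/
theorem UEA.induction {p : UEA k R L → Prop} (one : p 1) (add : ∀ u v, p u → p v → p (u + v))
    (fun_mul : ∀ f u, p u → p (ι₁ k R L f * u)) (sec_mul : ∀ X u, p u → p (ι₂ k R L X * u))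
    (u : UEA k R L) : p u := by
  have key : ∀ u ∈ Algebra.adjoin k (Set.range (ι₁ k R L) ∪ Set.range (ι₂ k R L)),
      ∀ v, p v → p (u * v) := by
    intro u hu
    induction hu using Algebra.adjoin_induction with
    | mem x hx =>
      rcases hx with ⟨f, rfl⟩ | ⟨X, rfl⟩
      · exact fun_mul f
      · exact sec_mul X
    | algebraMap c =>
      intro v hv
      rw [← (ι₁ k R L).commutes c]
      exact fun_mul _ v hv
    | add x y _ _ hx hy => intro v hv; rw [add_mul]; exact add _ _ (hx v hv) (hy v hv)
    | mul x y _ _ hx hy => intro v hv; rw [mul_assoc]; exact hx _ (hy v hv)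
  simpa using key u (by rw [UEA.adjoin_eq_top]; trivial) 1 one

end UniversalProperty

end LieRinehart

/-! ### Tensor products of modules over the universal enveloping algebra -/

namespace LieRinehart

attribute [local instance 100] LieRing.ofAssociativeRing

open RBimodule

section TensorModule

variable {k R L : Type*} [CommRing k] [CommRing R] [Algebra k R] [LieRing L] [LieAlgebra k L]
  [Module R L] [LieRingModule L R] [LieRinehartRing R L] [LieRinehartAlgebra k R L]
  {M N M' N' : Type*} [AddCommGroup M] [Module k M] [AddCommGroup N] [Module k N]
  [AddCommGroup M'] [Module k M'] [AddCommGroup N'] [Module k N']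

/-- The bimodule structure `B` on a module `θ` over the universal enveloping algebra is the
symmetric one given by the action of `R` through `ι₁`. -/
structure Restricts (θ : UEA k R L →ₐ[k] Module.End k M) (B : RBimodule k R M) : Prop where
  left : ∀ a m, B.left a m = θ (ι₁ k R L a) m
  right : ∀ a m, B.right (MulOpposite.op a) m = θ (ι₁ k R L a) m

theorem rep_ι₂_ι₁ (θ : UEA k R L →ₐ[k] Module.End k M) (X : L) (a : R) (m : M) :
    θ (ι₂ k R L X) (θ (ι₁ k R L a) m) =
      θ (ι₁ k R L a) (θ (ι₂ k R L X) m) + θ (ι₁ k R L ⁅X, a⁆) m := by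
  simpa using LinearMap.congr_fun (congrArg θ (ι₂_mul_ι₁ X a)) m

theorem rep_ι₂_lie (θ : UEA k R L →ₐ[k] Module.End k M) (X Y : L) (m : M) :
    θ (ι₂ k R L ⁅X, Y⁆) m =
      θ (ι₂ k R L X) (θ (ι₂ k R L Y) m) - θ (ι₂ k R L Y) (θ (ι₂ k R L X) m) := by
  simp [ι₂_lie]

theorem sub_tmul (B : RBimodule k R M) (C : RBimodule k R N) (m m' : M) (n : N) :
    tmul B C (m - m') n = tmul B C m n - tmul B C m' n := by
  simp [tmul, TensorProduct.sub_tmul]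

theorem tmul_sub (B : RBimodule k R M) (C : RBimodule k R N) (m : M) (n n' : N) :
    tmul B C m (n - n') = tmul B C m n - tmul B C m n' := by
  simp [tmul, TensorProduct.tmul_sub]

/-- A map which commutes with the generators is a map of modules over the universal enveloping
algebra. -/
theorem rep_comm (θ : UEA k R L →ₐ[k] Module.End k M) (σ : UEA k R L →ₐ[k] Module.End k N)
    (f : M →ₗ[k] N) (h₁ : ∀ a m, f (θ (ι₁ k R L a) m) = σ (ι₁ k R L a) (f m))
    (h₂ : ∀ X m, f (θ (ι₂ k R L X) m) = σ (ι₂ k R L X) (f m)) (u : UEA k R L) (m : M) :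
    f (θ u m) = σ u (f m) := by
  induction u using UEA.induction with
  | one => simp
  | add u v hu hv => simp [hu, hv]
  | fun_mul a u hu => simp [h₁, hu]
  | sec_mul X u hu => simp [h₂, hu]

variable {θ : UEA k R L →ₐ[k] Module.End k M} {B : RBimodule k R M}
  {σ : UEA k R L →ₐ[k] Module.End k N} {C : RBimodule k R N}
  {θ' : UEA k R L →ₐ[k] Module.End k M'} {B' : RBimodule k R M'}
  {σ' : UEA k R L →ₐ[k] Module.End k N'} {C' : RBimodule k R N'}

theorem Restricts.tmul_ι₁ (hB : Restricts θ B) (hC : Restricts σ C) (a : R) (m : M) (n : N) :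
    tmul B C (θ (ι₁ k R L a) m) n = tmul B C m (σ (ι₁ k R L a) n) := by
  rw [← hB.right, ← hC.left, tmul_balanced]

/-- The derivation rule `X (m ⊗ n) = X m ⊗ n + m ⊗ X n` on `M ⊗_R N`. The two summands are not
separately compatible with the relations of `M ⊗_R N`: their defects `± X(a) m ⊗ n` cancel. -/
def tensSec (hB : Restricts θ B) (hC : Restricts σ C) (X : L) : Module.End k (Tens B C) :=
  RBimodule.lift B C ((relations B C).mkQ ∘ₗ
    (TensorProduct.map (θ (ι₂ k R L X)) LinearMap.id +
      TensorProduct.map LinearMap.id (σ (ι₂ k R L X)))) (fun a m n => by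
    change tmul B C _ n + tmul B C _ _ = tmul B C _ _ + tmul B C m _
    simp only [LinearMap.id_apply]
    rw [hB.right, hC.left, rep_ι₂_ι₁, rep_ι₂_ι₁, add_tmul, tmul_add, hB.tmul_ι₁ hC, hB.tmul_ι₁ hC,
      hB.tmul_ι₁ hC]
    abel)

@[simp]
theorem tensSec_tmul (hB : Restricts θ B) (hC : Restricts σ C) (X : L) (m : M) (n : N) :
    tensSec hB hC X (tmul B C m n) =
      tmul B C (θ (ι₂ k R L X) m) n + tmul B C m (σ (ι₂ k R L X) n) := rfl

/-- The tensor product `M ⊗_R N` of two modules over the universal enveloping algebra. -/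
def tensRep (hB : Restricts θ B) (hC : Restricts σ C) :
    UEA k R L →ₐ[k] Module.End k (Tens B C) :=
  UEA.lift (tens B C).left
    { toFun := tensSec hB hC
      map_add' := fun X Y => tens_ext fun m n => by
        simp only [tensSec_tmul, map_add, LinearMap.add_apply, add_tmul, tmul_add]
        abel
      map_smul' := fun c X => tens_ext fun m n => by
        simp only [tensSec_tmul, map_smul, LinearMap.smul_apply, smul_tmul, tmul_smul, smul_add,
          RingHom.id_apply]
      map_lie' := fun {X Y} => tens_ext fun m n => by
        rw [LieRing.of_associative_ring_bracket]
        change tensSec hB hC ⁅X, Y⁆ (tmul B C m n) =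
          tensSec hB hC X (tensSec hB hC Y (tmul B C m n)) -
            tensSec hB hC Y (tensSec hB hC X (tmul B C m n))
        simp only [tensSec_tmul, map_add, rep_ι₂_lie, sub_tmul, tmul_sub]
        abel }
    (fun X f => tens_ext fun m n => by
      change tensSec hB hC X (tmul B C (B.left f m) n) =
        tensLeft B C f (tensSec hB hC X (tmul B C m n)) + tmul B C (B.left ⁅X, f⁆ m) n
      simp only [tensSec_tmul, map_add, tensLeft_tmul, hB.left, rep_ι₂_ι₁, add_tmul]
      abel)
    (fun f X => tens_ext fun m n => by
      change tensSec hB hC (f • X) (tmul B C m n) =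
        tensLeft B C f (tensSec hB hC X (tmul B C m n))
      simp only [tensSec_tmul, map_add, tensLeft_tmul, hB.left, ι₂_smul, map_mul,
        Module.End.mul_apply, hB.tmul_ι₁ hC])

@[simp]
theorem tensRep_ι₁ (hB : Restricts θ B) (hC : Restricts σ C) (a : R) (m : M) (n : N) :
    tensRep hB hC (ι₁ k R L a) (tmul B C m n) = tmul B C (θ (ι₁ k R L a) m) n := by
  rw [tensRep, UEA.lift_ι₁, ← hB.left]
  rfl

@[simp]
theorem tensRep_ι₂ (hB : Restricts θ B) (hC : Restricts σ C) (X : L) (m : M) (n : N) :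
    tensRep hB hC (ι₂ k R L X) (tmul B C m n) =
      tmul B C (θ (ι₂ k R L X) m) n + tmul B C m (σ (ι₂ k R L X) n) := by
  rw [tensRep, UEA.lift_ι₂]
  rfl

/-- The bimodule underlying the tensor product of modules is the tensor product of bimodules. -/
theorem Restricts.tens (hB : Restricts θ B) (hC : Restricts σ C) :
    Restricts (tensRep hB hC) (tens B C) where
  left a t := by
    rw [tensRep, UEA.lift_ι₁]
  right a t := by
    refine LinearMap.congr_fun (f := (RBimodule.tens B C).right (MulOpposite.op a))
      (tens_ext fun m n => ?_) t
    rw [tensRep_ι₁, hB.tmul_ι₁ hC, ← hC.right]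
    rfl

/-- To check that a map out of `M ⊗_R N` is a map of modules over the universal enveloping algebra,
it suffices to do so for generators acting on pure tensors. -/
theorem tensRep_comm (hB : Restricts θ B) (hC : Restricts σ C) (f : Tens B C →ₗ[k] M')
    (h₁ : ∀ a m n, f (tmul B C (θ (ι₁ k R L a) m) n) = θ' (ι₁ k R L a) (f (tmul B C m n)))
    (h₂ : ∀ X m n, f (tmul B C (θ (ι₂ k R L X) m) n + tmul B C m (σ (ι₂ k R L X) n)) =
      θ' (ι₂ k R L X) (f (tmul B C m n))) (u : UEA k R L) (t : Tens B C) :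
    f (tensRep hB hC u t) = θ' u (f t) := by
  refine rep_comm _ _ f (fun a t => ?_) (fun X t => ?_) u t
  · exact LinearMap.congr_fun (f := f ∘ₗ tensRep hB hC (ι₁ k R L a))
      (g := θ' (ι₁ k R L a) ∘ₗ f) (tens_ext fun m n => by simp [h₁]) t
  · exact LinearMap.congr_fun (f := f ∘ₗ tensRep hB hC (ι₂ k R L X))
      (g := θ' (ι₂ k R L X) ∘ₗ f) (tens_ext fun m n => by simp [← h₂]) t

theorem isHom_of_rep_comm (hB : Restricts θ B) (hB' : Restricts θ' B') (f : M →ₗ[k] M')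
    (h : ∀ u m, f (θ u m) = θ' u (f m)) : IsHom B B' f where
  map_left a m := by rw [hB.left, hB'.left, h]
  map_right b m := by rw [← MulOpposite.op_unop b, hB.right, hB'.right, h]

/-- The tensor product of two module maps is a module map. -/
theorem map_rep_comm (hB : Restricts θ B) (hC : Restricts σ C) (hB' : Restricts θ' B')
    (hC' : Restricts σ' C') (f : M →ₗ[k] M') (hf : IsHom B B' f) (g : N →ₗ[k] N')
    (hg : IsHom C C' g) (hf' : ∀ u m, f (θ u m) = θ' u (f m))
    (hg' : ∀ u n, g (σ u n) = σ' u (g n)) (u : UEA k R L) (t : Tens B C) :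
    RBimodule.map f hf g hg (tensRep hB hC u t) =
      tensRep hB' hC' u (RBimodule.map f hf g hg t) :=
  tensRep_comm hB hC _ (fun a m n => by simp [hf']) (fun X m n => by simp [hf', hg']) u t

/-- The associativity isomorphism is a map of modules over the universal enveloping algebra. -/
theorem assoc_rep_comm (hB : Restricts θ B) (hC : Restricts σ C) (hB' : Restricts θ' B')
    (u : UEA k R L) (t : Tens (tens B C) B') :
    assoc B C B' (tensRep (hB.tens hC) hB' u t) = tensRep hB (hC.tens hB') u (assoc B C B' t) := by
  -- Maps out of the iterated tensor product agree once they agree on `(m ⊗ n) ⊗ l`.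
  have ext3 : ∀ {K : Type _} [AddCommGroup K] [Module k K] (f g : Tens (tens B C) B' →ₗ[k] K),
      (∀ m n l, f (tmul _ B' (tmul B C m n) l) = g (tmul _ B' (tmul B C m n) l)) → f = g := by
    intro K _ _ f g h
    refine tens_ext fun s l => ?_
    have e := tens_ext (B := B) (C := C)
      (f := f ∘ₗ (relations (tens B C) B').mkQ ∘ₗ (TensorProduct.mk k _ _).flip l)
      (g := g ∘ₗ (relations (tens B C) B').mkQ ∘ₗ (TensorProduct.mk k _ _).flip l)
      fun m n => h m n l
    exact LinearMap.congr_fun e s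
  refine rep_comm _ _ (assoc B C B') (fun a t => ?_) (fun X t => ?_) u t
  · exact LinearMap.congr_fun
      (f := assoc B C B' ∘ₗ tensRep (hB.tens hC) hB' (ι₁ k R L a))
      (g := tensRep hB (hC.tens hB') (ι₁ k R L a) ∘ₗ assoc B C B')
      (ext3 _ _ fun m n l => by simp) t
  · exact LinearMap.congr_fun
      (f := assoc B C B' ∘ₗ tensRep (hB.tens hC) hB' (ι₂ k R L X))
      (g := tensRep hB (hC.tens hB') (ι₂ k R L X) ∘ₗ assoc B C B')
      (ext3 _ _ fun m n l => by simp [add_tmul, tmul_add, add_assoc]) t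

end TensorModule

end LieRinehart

namespace LieRinehart

attribute [local instance 100] LieRing.ofAssociativeRing

open RBimodule

/-! ### The action on functions and the counit -/

section Functions

variable (k R L : Type*) [CommRing k] [CommRing R] [Algebra k R] [LieRing L] [LieAlgebra k L]
  [Module R L] [LieRingModule L R] [LieRinehartRing R L] [LieRinehartAlgebra k R L]

/-- The representation of the universal enveloping algebra on `R`: elements of `R` act by
multiplication, elements of `L` as derivations. -/
def anchorRep : UEA k R L →ₐ[k] Module.End k R :=
  UEA.lift (Algebra.lmul k R) (LieModule.toEnd k L R)
    (fun X f => LinearMap.ext fun g => by simp [mul_comm])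
    (fun f X => LinearMap.ext fun g => by simp)

variable {k R L}

@[simp]
theorem anchorRep_ι₁ (f g : R) : anchorRep k R L (ι₁ k R L f) g = f * g := by
  rw [anchorRep, UEA.lift_ι₁]
  rfl

@[simp]
theorem anchorRep_ι₂ (X : L) (g : R) : anchorRep k R L (ι₂ k R L X) g = ⁅X, g⁆ := by
  rw [anchorRep, UEA.lift_ι₂]
  rfl

theorem ι₁_injective : Function.Injective (ι₁ k R L) := fun f g h => by
  simpa using LinearMap.congr_fun (congrArg (anchorRep k R L) h) 1

theorem lie_one (X : L) : ⁅X, (1 : R)⁆ = 0 := by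
  simpa using LieRinehartRing.leibniz_mul_right X (1 : R) 1

theorem restricts_regular : Restricts (anchorRep k R L) (regular k R) where
  left a m := by simp [regular]
  right a m := by simp [regular, mul_comm]

variable (k R L)

/-- The counit `u ↦ u(1)`. -/
def counit : UEA k R L →ₗ[k] R := LinearMap.applyₗ (1 : R) ∘ₗ (anchorRep k R L).toLinearMap

variable {k R L}

theorem counit_apply (u : UEA k R L) : counit k R L u = anchorRep k R L u 1 := rfl

@[simp]
theorem counit_ι₁ (f : R) : counit k R L (ι₁ k R L f) = f := by simp [counit_apply]

/-- The counit is a map of modules `U → R`. -/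
theorem counit_mul (u v : UEA k R L) :
    counit k R L (u * v) = anchorRep k R L u (counit k R L v) := by
  simp [counit_apply]

/-- Modulo the left ideal generated by the sections, `u` is the function `ε(u)`. -/
theorem sub_counit_mem_span (u : UEA k R L) :
    u - ι₁ k R L (counit k R L u) ∈ Ideal.span (Set.range (ι₂ k R L)) := by
  induction u using UEA.induction with
  | one => simp [counit_apply]
  | add u v hu hv => simpa [add_sub_add_comm] using add_mem hu hv
  | fun_mul f u hu =>
    rw [counit_mul, anchorRep_ι₁, map_mul, ← mul_sub]
    exact Ideal.mul_mem_left _ _ hu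
  | sec_mul X u hu =>
    have e : ι₂ k R L X * u - ι₁ k R L (counit k R L (ι₂ k R L X * u)) =
        ι₂ k R L X * (u - ι₁ k R L (counit k R L u)) +
          ι₁ k R L (counit k R L u) * ι₂ k R L X := by
      rw [counit_mul, anchorRep_ι₂, mul_sub, ι₂_mul_ι₁]
      abel
    rw [e]
    exact add_mem (Ideal.mul_mem_left _ _ hu)
      (Ideal.mul_mem_left _ _ (Ideal.subset_span ⟨X, rfl⟩))

/-- The kernel of the counit is the left ideal generated by the sections. -/
theorem counit_eq_zero_iff (u : UEA k R L) :
    counit k R L u = 0 ↔ u ∈ Ideal.span (Set.range (ι₂ k R L)) := by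
  refine ⟨fun h => by simpa [h] using sub_counit_mem_span u, fun h => ?_⟩
  induction h using Submodule.span_induction with
  | mem x hx =>
    obtain ⟨X, rfl⟩ := hx
    simp [counit_apply, lie_one]
  | zero => simp
  | add x y _ _ hx hy => simp [hx, hy]
  | smul a x _ hx => simp [counit_mul, hx]

end Functions

/-! ### The Hopf algebroid structure -/

section Coproduct

variable (k R L : Type*) [CommRing k] [CommRing R] [Algebra k R] [LieRing L] [LieAlgebra k L]
  [Module R L] [LieRingModule L R] [LieRinehartRing R L] [LieRinehartAlgebra k R L]

/-- The source and target maps of the universal enveloping algebra, both equal to `ι₁`. -/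
def sourceTarget : SourceTarget k R (UEA k R L) where
  source := ι₁ k R L
  target := (ι₁ k R L).comp (AlgEquiv.toOpposite k R).symm.toAlgHom
  source_target a b := by
    change ι₁ k R L a * ι₁ k R L b.unop = ι₁ k R L b.unop * ι₁ k R L a
    rw [← map_mul, ← map_mul, mul_comm]

variable {k R L}

theorem restricts_bimod :
    Restricts (Algebra.lmul k (UEA k R L)) (sourceTarget k R L).bimod where
  left _ _ := rfl
  right _ _ := rfl

variable (k R L)

/-- The left action of the universal enveloping algebra `U` on `U ⊗_R U`. -/
def diagRep : UEA k R L →ₐ[k] Module.End k (sourceTarget k R L).HH :=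
  tensRep restricts_bimod restricts_bimod

/-- The coproduct `Δ(u) = u · (1 ⊗ 1)`. -/
def comul : UEA k R L →ₗ[k] (sourceTarget k R L).HH :=
  LinearMap.applyₗ (tmul _ _ 1 1) ∘ₗ (diagRep k R L).toLinearMap

variable {k R L}

theorem comul_apply (u : UEA k R L) : comul k R L u = diagRep k R L u (tmul _ _ 1 1) := rfl

/-- The coproduct is a map of modules `U → U ⊗_R U`. -/
theorem comul_mul (u v : UEA k R L) : comul k R L (u * v) = diagRep k R L u (comul k R L v) := by
  simp [comul_apply]

theorem comul_isHom : IsHom (sourceTarget k R L).bimod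
    (tens (sourceTarget k R L).bimod (sourceTarget k R L).bimod) (comul k R L) :=
  isHom_of_rep_comm restricts_bimod (restricts_bimod.tens restricts_bimod) _ comul_mul

theorem counit_isHom : IsHom (sourceTarget k R L).bimod (regular k R) (counit k R L) :=
  isHom_of_rep_comm restricts_bimod restricts_regular _ counit_mul

/-- A module map from `U ⊗_R U` is determined on the image of the coproduct by its value at
`1 ⊗ 1`. -/
theorem apply_comul {M : Type*} [AddCommGroup M] [Module k M]
    {θ : UEA k R L →ₐ[k] Module.End k M} {f : (sourceTarget k R L).HH →ₗ[k] M}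
    (hf : ∀ u t, f (diagRep k R L u t) = θ u (f t)) (u : UEA k R L) :
    f (comul k R L u) = θ u (f (tmul _ _ 1 1)) := by
  rw [comul_apply, hf]

/-- Right multiplication on `U ⊗_R U` commutes with the diagonal left action. -/
theorem rightMul_diagRep (w : UEA k R L ⊗[k] UEA k R L) (u : UEA k R L)
    (t : (sourceTarget k R L).HH) :
    (sourceTarget k R L).rightMul w (diagRep k R L u t) =
      diagRep k R L u ((sourceTarget k R L).rightMul w t) := by
  induction w using TensorProduct.induction_on with
  | zero =>
    have : (sourceTarget k R L).rightMul 0 = 0 :=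
      tens_ext fun m n => by simp [SourceTarget.rightMul]
    simp [this]
  | tmul p q =>
    have h : ∀ x y, (sourceTarget k R L).rightMul (p ⊗ₜ q) (tmul _ _ x y) =
        tmul _ _ (x * p) (y * q) := fun x y => by
      change (relations _ _).mkQ ((x ⊗ₜ[k] y) * (p ⊗ₜ[k] q)) = _
      rw [Algebra.TensorProduct.tmul_mul_tmul]
      rfl
    refine tensRep_comm _ _ _ (fun a m n => ?_) (fun X m n => ?_) u t
    · rw [h, h, diagRep, tensRep_ι₁]
      simp [mul_assoc]
    · rw [map_add, h, h, h, diagRep, tensRep_ι₂]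
      simp [mul_assoc]
  | add v w hv hw =>
    have : (sourceTarget k R L).rightMul (v + w) =
        (sourceTarget k R L).rightMul v + (sourceTarget k R L).rightMul w :=
      tens_ext fun m n => by simp [SourceTarget.rightMul, mul_add]
    simp [this, hv, hw]

/-- `Δ(u) w = u · [w]`, where `[w]` is the class of `w` in `U ⊗_R U`. -/
theorem rightMul_comul (w : UEA k R L ⊗[k] UEA k R L) (u : UEA k R L) :
    (sourceTarget k R L).rightMul w (comul k R L u) =
      diagRep k R L u ((relations _ _).mkQ w) := by
  rw [apply_comul (rightMul_diagRep w)]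
  change diagRep k R L u ((relations _ _).mkQ (((1 : UEA k R L) ⊗ₜ[k] (1 : UEA k R L)) * w)) = _
  rw [← Algebra.TensorProduct.one_def, one_mul]

/-- `Δ(u) (a ⊗ 1 - 1 ⊗ a) = 0`, because the class of `a ⊗ 1 - 1 ⊗ a` in `U ⊗_R U` vanishes. -/
theorem comul_rightMul (u : UEA k R L) (a : R) :
    (sourceTarget k R L).rightMul
      ((sourceTarget k R L).target (MulOpposite.op a) ⊗ₜ[k] 1 -
        1 ⊗ₜ[k] (sourceTarget k R L).source a) (comul k R L u) = 0 := by
  have h : (relations (sourceTarget k R L).bimod (sourceTarget k R L).bimod).mkQ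
      ((sourceTarget k R L).target (MulOpposite.op a) ⊗ₜ[k] 1 -
        1 ⊗ₜ[k] (sourceTarget k R L).source a) = 0 := by
    rw [Submodule.mkQ_apply, Submodule.Quotient.mk_eq_zero]
    exact Submodule.subset_span ⟨a, 1, 1, by simp⟩
  rw [rightMul_comul, h, map_zero]

/-- Multiplication by `Δ(u)` on `U ⊗_R U` is the diagonal action of `u`. -/
theorem mulOn_comul (u : UEA k R L) (t : (sourceTarget k R L).HH) :
    (sourceTarget k R L).mulOn (comul k R L u) (comul_rightMul u) t = diagRep k R L u t := by
  refine LinearMap.congr_fun (g := diagRep k R L u) (tens_ext fun m n => ?_) t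
  exact rightMul_comul (m ⊗ₜ n) u

theorem lid_tmul_bimod (a : R) (u : UEA k R L) :
    lid (sourceTarget k R L).bimod (tmul (regular k R) (sourceTarget k R L).bimod a u) =
      ι₁ k R L a * u := rfl

theorem rid_tmul_bimod (a : R) (u : UEA k R L) :
    rid (sourceTarget k R L).bimod (tmul (sourceTarget k R L).bimod (regular k R) u a) =
      ι₁ k R L a * u := rfl

variable (k R L)

/-- The Hopf algebroid structure of the universal enveloping algebra of a Lie-Rinehart algebra. -/
def hopfAlgebroid : HopfAlgebroid k R (UEA k R L) where
  toSourceTarget := sourceTarget k R L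
  comul := comul k R L
  comul_isHom := comul_isHom
  comul_one := by simp [comul_apply]
  coassoc u := by
    have hU := restricts_bimod (k := k) (R := R) (L := L)
    have h₁ := map_rep_comm hU hU (hU.tens hU) hU _ comul_isHom _ (isHom_id _) comul_mul
      (fun _ _ => rfl)
    have h₂ := map_rep_comm hU hU hU (hU.tens hU) _ (isHom_id _) _ comul_isHom
      (fun _ _ => rfl) comul_mul
    have h₃ := assoc_rep_comm hU hU hU
    rw [apply_comul h₁, apply_comul h₂, h₃]
    simp [comul_apply]
  comul_rightMul := comul_rightMul
  comul_mul u v := by rw [mulOn_comul, comul_mul]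
  counit := counit k R L
  counit_isHom := counit_isHom
  counit_one := by simp [counit_apply]
  counit_comul u := by
    have hU := restricts_bimod (k := k) (R := R) (L := L)
    have h₁ := map_rep_comm hU hU restricts_regular hU _ counit_isHom _ (isHom_id _) counit_mul
      (fun _ _ => rfl)
    have h₂ := tensRep_comm (θ' := Algebra.lmul k (UEA k R L)) restricts_regular hU
      (lid (sourceTarget k R L).bimod) (fun a m n => by simp [lid_tmul_bimod, mul_assoc])
      (fun X m n => by
        simp only [map_add, lid_tmul_bimod, anchorRep_ι₂, Algebra.coe_lmul_eq_mul,
          LinearMap.mul_apply', ← mul_assoc, ι₂_mul_ι₁]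
        simp only [add_mul, mul_assoc]
        abel)
    rw [apply_comul h₁, h₂]
    simp [lid_tmul_bimod, counit_apply]
  comul_counit u := by
    have hU := restricts_bimod (k := k) (R := R) (L := L)
    have h₁ := map_rep_comm hU hU hU restricts_regular _ (isHom_id _) _ counit_isHom
      (fun _ _ => rfl) counit_mul
    have h₂ := tensRep_comm (θ' := Algebra.lmul k (UEA k R L)) hU restricts_regular
      (rid (sourceTarget k R L).bimod)
      (fun a m n => by
        simp only [rid_tmul_bimod, Algebra.coe_lmul_eq_mul, LinearMap.mul_apply', ← mul_assoc,
          ← map_mul, mul_comm])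
      (fun X m n => by
        simp only [map_add, rid_tmul_bimod, anchorRep_ι₂, Algebra.coe_lmul_eq_mul,
          LinearMap.mul_apply', ← mul_assoc, ι₂_mul_ι₁]
        simp only [add_mul, mul_assoc])
    rw [apply_comul h₁, h₂]
    simp [rid_tmul_bimod, counit_apply]

theorem hopfAlgebroid_source_eq_target (a : R) :
    (hopfAlgebroid k R L).source a = (hopfAlgebroid k R L).target (MulOpposite.op a) := rfl

variable {k R L}

theorem hopfAlgebroid_comul_ι₁ (f : R) : (hopfAlgebroid k R L).comul (ι₁ k R L f) =
    (hopfAlgebroid k R L).bimod.tmul (hopfAlgebroid k R L).bimod (ι₁ k R L f) 1 := by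
  refine (comul_apply _).trans ?_
  rw [diagRep, tensRep_ι₁]
  simp
  rfl

theorem hopfAlgebroid_comul_ι₂ (X : L) : (hopfAlgebroid k R L).comul (ι₂ k R L X) =
    (hopfAlgebroid k R L).bimod.tmul (hopfAlgebroid k R L).bimod (ι₂ k R L X) 1 +
      (hopfAlgebroid k R L).bimod.tmul (hopfAlgebroid k R L).bimod 1 (ι₂ k R L X) := by
  refine (comul_apply _).trans ?_
  rw [diagRep, tensRep_ι₂]
  simp
  rfl

/-- The coproduct is invariant under the flip: the flip is a module map which fixes `1 ⊗ 1`. -/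
theorem apply_comul_of_flip {f : (sourceTarget k R L).HH →ₗ[k] (sourceTarget k R L).HH}
    (hf : ∀ u v, f (tmul _ _ u v) = tmul _ _ v u) (u : UEA k R L) :
    f (comul k R L u) = comul k R L u := by
  have hU := restricts_bimod (k := k) (R := R) (L := L)
  have h := tensRep_comm (θ' := diagRep k R L) hU hU f
    (fun a m n => by rw [hf, hf, diagRep, tensRep_ι₁, hU.tmul_ι₁ hU])
    (fun X m n => by rw [map_add, hf, hf, hf, diagRep, tensRep_ι₂, add_comm])
  rw [apply_comul h, hf, comul_apply]

/-- The first anchor identity `∑ u₁(a) u₂ = u a`: the map `u ⊗ v ↦ u(a) v` is a module map with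
value `a` at `1 ⊗ 1`. -/
theorem apply_comul_of_anchor_left (a : R) {f : (sourceTarget k R L).HH →ₗ[k] UEA k R L}
    (hf : ∀ u v, f (tmul _ _ u v) = ι₁ k R L (anchorRep k R L u a) * v) (u : UEA k R L) :
    f (comul k R L u) = u * ι₁ k R L a := by
  have hU := restricts_bimod (k := k) (R := R) (L := L)
  have h := tensRep_comm (θ' := Algebra.lmul k (UEA k R L)) hU hU f
    (fun b m n => by simp [hf, mul_assoc])
    (fun X m n => by
      simp only [map_add, hf, Algebra.coe_lmul_eq_mul, LinearMap.mul_apply', map_mul,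
        Module.End.mul_apply, anchorRep_ι₂, ← mul_assoc, ι₂_mul_ι₁]
      simp only [add_mul, mul_assoc]
      abel)
  rw [apply_comul h, hf]
  simp

/-- The second anchor identity, the first one composed with the flip. -/
theorem apply_comul_of_anchor_right (a : R) {f : (sourceTarget k R L).HH →ₗ[k] UEA k R L}
    (hf : ∀ u v, f (tmul _ _ u v) = ι₁ k R L (anchorRep k R L v a) * u) (u : UEA k R L) :
    f (comul k R L u) = u * ι₁ k R L a := by
  have h := apply_comul_of_anchor_left a
    (f := f ∘ₗ (hopfAlgebroid k R L).flip (hopfAlgebroid_source_eq_target k R L))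
    (fun m n => hf n m) u
  exact (congrArg f (apply_comul_of_flip (fun _ _ => rfl) u)).symm.trans h

theorem hopfAlgebroid_isCocommutative : (hopfAlgebroid k R L).IsCocommutative :=
  ⟨hopfAlgebroid_source_eq_target k R L, apply_comul_of_flip fun _ _ => rfl⟩

theorem hopfAlgebroid_isAnchor : (hopfAlgebroid k R L).IsAnchor (anchorRep k R L) where
  isHom :=
    { map_left := fun a _ => (map_mul (anchorRep k R L) _ _).trans
        (LinearMap.ext fun _ => anchorRep_ι₁ a _)
      map_right := fun a _ => (map_mul (anchorRep k R L) _ _).trans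
        (LinearMap.ext fun _ => (anchorRep_ι₁ a.unop _).trans (mul_comm _ _)) }
  phiSource_comul u a := apply_comul_of_anchor_left a (fun _ _ => rfl) u
  phiTarget_comul u a := apply_comul_of_anchor_right a (fun _ _ => rfl) u
  apply_one _ := rfl

end Coproduct

end LieRinehart

/-! ### The case of a Lie algebroid -/

namespace LieAlgebroid

variable {E : Type*} [NormedAddCommGroup E] [NormedSpace ℝ E] [FiniteDimensional ℝ E]
  {H : Type*} [TopologicalSpace H] {I : ModelWithCorners ℝ E H}
  {P : Type*} [TopologicalSpace P] [ChartedSpace H P] [IsManifold I ∞ P]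
  {F : Type*} [NormedAddCommGroup F] [NormedSpace ℝ F]
  {V : P → Type*} [TopologicalSpace (Bundle.TotalSpace F V)] [∀ p, TopologicalSpace (V p)]
  [FiberBundle F V] [∀ p, AddCommGroup (V p)] [∀ p, Module ℝ (V p)] [VectorBundle ℝ F V]
  (A : LieAlgebroid I F V)

theorem anchorRep_mem_diffOperators (u : A.UA) :
    LieRinehart.anchorRep ℝ C^∞⟮I, P; 𝓘(ℝ, ℝ), ℝ⟯ A.Sec u ∈ diffOperators I P := by
  induction u using LieRinehart.UEA.induction with
  | one => rw [map_one]; exact one_mem _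
  | add u v hu hv => rw [map_add]; exact add_mem hu hv
  | fun_mul f u hu =>
    rw [map_mul]
    refine mul_mem (Algebra.subset_adjoin (Or.inl ⟨f, ?_⟩)) hu
    exact LinearMap.ext fun g => (LieRinehart.anchorRep_ι₁ f g).symm
  | sec_mul X u hu =>
    rw [map_mul]
    refine mul_mem (Algebra.subset_adjoin (Or.inr ⟨A.anchor.onSections X, ?_⟩)) hu
    exact LinearMap.ext fun g => (LieRinehart.anchorRep_ι₂ X g).symm

/-- The representation of `UA` on functions by differential operators. -/
noncomputable def toDiffOperators : A.UA →ₐ[ℝ] diffOperators I P :=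
  (LieRinehart.anchorRep ℝ C^∞⟮I, P; 𝓘(ℝ, ℝ), ℝ⟯ A.Sec).codRestrict (diffOperators I P)
    A.anchorRep_mem_diffOperators

end LieAlgebroid

theorem mainTheorem10 {E : Type*} [NormedAddCommGroup E] [NormedSpace ℝ E] [FiniteDimensional ℝ E]
    {H : Type*} [TopologicalSpace H] (I : ModelWithCorners ℝ E H)
    {P : Type*} [TopologicalSpace P] [ChartedSpace H P] [IsManifold I ∞ P]
    [BoundarylessManifold I P] [T2Space P] [SecondCountableTopology P]
    (F : Type*) [NormedAddCommGroup F] [NormedSpace ℝ F] [FiniteDimensional ℝ F]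
    (V : P → Type*) [TopologicalSpace (Bundle.TotalSpace F V)] [∀ p, TopologicalSpace (V p)]
    [FiberBundle F V] [∀ p, AddCommGroup (V p)] [∀ p, Module ℝ (V p)] [VectorBundle ℝ F V]
    [ContMDiffVectorBundle ∞ F V I]
    (A : LieAlgebroid I F V) :
    Function.Injective A.i₁ ∧
    ∃ (𝓗 : HopfAlgebroid ℝ C^∞⟮I, P; 𝓘(ℝ, ℝ), ℝ⟯ A.UA) (ρ : A.UA →ₐ[ℝ] diffOperators I P),
      -- the source and target maps
      (∀ f, 𝓗.source f = A.i₁ f) ∧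
      (∀ f, 𝓗.target (MulOpposite.op f) = A.i₁ f) ∧
      -- the coproduct
      (∀ f, 𝓗.comul (A.i₁ f) = 𝓗.bimod.tmul 𝓗.bimod (A.i₁ f) 1) ∧
      (∀ X, 𝓗.comul (A.i₂ X) =
        𝓗.bimod.tmul 𝓗.bimod (A.i₂ X) 1 + 𝓗.bimod.tmul 𝓗.bimod 1 (A.i₂ X)) ∧
      𝓗.IsCocommutative ∧
      -- the homomorphism to differential operators extends the anchor, and gives the anchor map
      (∀ f g, (ρ (A.i₁ f) : Module.End ℝ C^∞⟮I, P; 𝓘(ℝ, ℝ), ℝ⟯) g = f * g) ∧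
      (∀ X f, (ρ (A.i₂ X) : Module.End ℝ C^∞⟮I, P; 𝓘(ℝ, ℝ), ℝ⟯) f = A.anchorDerivation X f) ∧
      𝓗.IsAnchor ((diffOperators I P).val.comp ρ) ∧
      -- the counit is the projection onto functions along the left ideal generated by the sections
      (∀ f, 𝓗.counit (A.i₁ f) = f) ∧
      (∀ x, 𝓗.counit x = 0 ↔ x ∈ Ideal.span (Set.range A.i₂)) := by
  open LieRinehart in
  refine ⟨ι₁_injective, hopfAlgebroid ℝ _ A.Sec, A.toDiffOperators, fun _ => rfl, fun _ => rfl,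
    hopfAlgebroid_comul_ι₁, hopfAlgebroid_comul_ι₂, hopfAlgebroid_isCocommutative, anchorRep_ι₁,
    anchorRep_ι₂, hopfAlgebroid_isAnchor, counit_ι₁, counit_eq_zero_iff⟩
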